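/- Let $\mathbb F_q$ be the finite field with $q$ elements, $n\ge 2$, and let $N:\mathbb F_{q^n}\to\mathbb F_q$ be the norm map $N(X)=\prod_{i=0}^{n-1}X^{q^i}$ (so $N(0)=0$). Let $t$ be fixed. For a set $S$ of pairs $(i,j)$ with $1\le i<j\le t$, a set $\mathcal A\subseteq\mathbb F_{q^n}$ and elements $\lambda_{ij}\in\mathbb F_q$, consider the system of $l=|S|\le\binom t2$ norm equations $$N(X_i+X_j)=\lambda_{ij}\quad((i,j)\in S),\qquad X_1,\dots,X_t\in\mathcal A. \tag{1}$$ (a) Let $S$ consist of all $\binom t2$ pairs. If $|\mathcal A|\gg q^{(n+t)/2}$, then (1) is solvable for at least $(1-o(1))\,q^{\binom t2}$ choices of $(\lambda_{ij})_{1\le i<j\le t}\in\mathbb F_q^{\binom t2}$. (b) Suppose that each variable appears in at most $k\le t-1$ of the equations of (1), and that $|\mathcal A|\gg q^{n/2+t-1}$. Then for any $\lambda_{ij}\in\mathbb F_q^{*}$, the system (1) has $(1+o(1))\,q^{-l}|\mathcal A|^t$ solutions $(X_1,\dots,X_t)\in\mathcal A^t$. Here $X\gg Y$ means $Y=o(X)$,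 and all asymptotics are for $q\to\infty$ with $t$ fixed, uniformly in everything else. Explicitly: for every $t$ and every $\varepsilon>0$ there are $C>0$ and $q_0$ such that for all prime powers $q\ge q_0$, all $n\ge2$ and all $\mathcal A\subseteq\mathbb F_{q^n}$: in (a), if $|\mathcal A|\ge C q^{(n+t)/2}$, the number of choices of $(\lambda_{ij})$ for which (1) is solvable is at least $(1-\varepsilon)q^{\binom t2}$; in (b), if $|\mathcal A|\ge C q^{n/2+t-1}$, then for every such $S$ and all $\lambda_{ij}\in\mathbb F_q^*$ the number of solutions differs from $q^{-l}|\mathcal A|^t$ by at most $\varepsilon\, q^{-l}|\mathcal A|^t$. -/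

import Mathlib

universe u v

/-- Index pairs `(i, j)` with `i < j`, for `t` variables. -/
abbrev IndexPair (t : ℕ) : Type := {p : Fin t × Fin t // p.1 < p.2}

/-- `X = (X_1, …, X_t)` solves the system `N(X_i + X_j) = lam_{ij}` (one equation for each pair
`(i, j) ∈ S`), with all variables `X_i` taken from `A`. Here `N` is the norm of `K / F`. -/
def SolvesNormSystem (F : Type*) {K : Type*} [Field F] [Field K] [Algebra F K] {t : ℕ}
    (A : Finset K) (S : Finset (IndexPair t)) (lam : IndexPair t → F) (X : Fin t → K) : Prop :=
  (∀ i, X i ∈ A) ∧ ∀ p ∈ S, Algebra.norm F (X p.1.1 + X p.1.2) = lam p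

/-- The number of equations of the system indexed by `S` in which the variable `X_i` appears. -/
def occurrences {t : ℕ} (S : Finset (IndexPair t)) (i : Fin t) : ℕ :=
  (S.filter fun p => p.1.1 = i ∨ p.1.2 = i).card

/-- The number of solutions of the norm system indexed by `S` with variables in `A`. -/
noncomputable def numSolutions (F : Type*) {K : Type*} [Field F] [Field K] [Algebra F K] {t : ℕ}
    (A : Finset K) (S : Finset (IndexPair t)) (lam : IndexPair t → F) : ℕ :=
  {X : Fin t → K | SolvesNormSystem F A S lam X}.ncard

/-- The number of choices of right-hand sides `lam_{ij} ∈ F`, `i < j`, for which the system of all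
`t choose 2` norm equations is solvable with variables in `A`. -/
noncomputable def numSolvable (F : Type*) {K : Type*} [Field F] [Field K] [Algebra F K] (t : ℕ)
    (A : Finset K) : ℕ :=
  {lam : IndexPair t → F | ∃ X : Fin t → K, SolvesNormSystem F A Finset.univ lam X}.ncard

/-!
For `c ≠ 0` the relation `N(x + y) = c` on `K` is pseudorandom. Orthogonality of the multiplicative
characters `χ` of `F` writes its indicator minus the density `1 / (q - 1)` as a combination of the
matrices with entries `χ(N(x + y))`, `χ ≠ 1`, up to a correction for `N = 0`. By Jacobi sums these
matrices have operator norm at most `√|K|`. Tensoring two of them treats the relation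
`N(x + y) = N(x' + y')` on `K × K` in the same way.

Solutions of a system of pseudorandom constraints are counted by removing the constraints one at a
time. When all variables but `x_i` and `x_j` are fixed, the remaining constraints without `(i, j)`
confine `x_i` and `x_j` to independent sets, between which the constraint `(i, j)` is pseudorandom.
Summing over the fixed variables by Cauchy–Schwarz bounds the error by the counts of the systems in
which `x_i`, respectively `x_j`, is free. Such a count is larger than expected for the full system
by a factor `q ^ d`, with `d` the number of constraints on the freed variable, which is why
`|A| ≫ q ^ (n / 2 + d)` suffices.

For part (a), the systems `N(X_i + X_j) = N(Y_i + Y_j)` over `A × A` count the collisions of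
`X ↦ (N(X_i + X_j))`, and Cauchy–Schwarz turns few collisions into a large image.
-/

open Finset Function

section ConstraintSystems

variable {V : Type*} {t : ℕ}

lemma sum_piFinset_sum_update {ι M : Type*} {α : ι → Type*} [Fintype ι] [DecidableEq ι]
    [AddCommMonoid M] (A : ∀ i, Finset (α i)) (i : ι) (f : (∀ i, α i) → M) :
    ∑ X ∈ Fintype.piFinset A, ∑ x ∈ A i, f (update X i x) =
      #(A i) • ∑ X ∈ Fintype.piFinset A, f X := by
  have hswap : ∀ z ∈ Fintype.piFinset A ×ˢ A i,
      (update z.1 i z.2, z.1 i) ∈ Fintype.piFinset A ×ˢ A i := by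
    rintro ⟨X, x⟩ h
    simp only [mem_product, Fintype.mem_piFinset] at h ⊢
    refine ⟨fun j => ?_, h.1 i⟩
    rcases eq_or_ne j i with rfl | hj
    · simpa using h.2
    · simpa [hj] using h.1 j
  calc ∑ X ∈ Fintype.piFinset A, ∑ x ∈ A i, f (update X i x)
      = ∑ z ∈ Fintype.piFinset A ×ˢ A i, f (update z.1 i z.2) :=
        (sum_product' _ _ fun X x => f (update X i x)).symm
    _ = ∑ z ∈ Fintype.piFinset A ×ˢ A i, f z.1 :=
        sum_nbij' (fun z => (update z.1 i z.2, z.1 i)) (fun z => (update z.1 i z.2, z.1 i))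
          hswap hswap (by simp) (by simp) (by simp)
    _ = #(A i) • ∑ X ∈ Fintype.piFinset A, f X := by
        simp only [sum_product, sum_const, smul_sum]

/-- The pairs of `S` that do not involve the index `i`. -/
def deleteIndex (S : Finset (IndexPair t)) (i : Fin t) : Finset (IndexPair t) :=
  {p ∈ S | ¬(p.1.1 = i ∨ p.1.2 = i)}

lemma card_deleteIndex_add_occurrences (S : Finset (IndexPair t)) (i : Fin t) :
    #(deleteIndex S i) + occurrences S i = #S := by
  rw [add_comm]
  exact card_filter_add_card_filter_not _

lemma occurrences_mono {S T : Finset (IndexPair t)} (h : S ⊆ T) (i : Fin t) :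
    occurrences S i ≤ occurrences T i :=
  card_le_card (filter_subset_filter _ h)

lemma occurrences_lt (S : Finset (IndexPair t)) (i : Fin t) : occurrences S i < t := by
  have h : occurrences S i ≤ #(univ.erase i) := by
    refine card_le_card_of_injOn (fun p => if p.1.1 = i then p.1.2 else p.1.1) ?_ ?_
    · rintro ⟨⟨a, b⟩, hab⟩ -
      simp only [coe_erase, coe_univ, Set.mem_sdiff, Set.mem_univ, Set.mem_singleton_iff, true_and]
      grind
    · rintro ⟨⟨a, b⟩, hab⟩ h ⟨⟨c, d⟩, hcd⟩ h' e
      simp only [coe_filter, Set.mem_ofPred_eq] at h h' hab hcd e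
      simp only [Subtype.mk.injEq, Prod.mk.injEq]
      grind
  rw [card_erase_of_mem (mem_univ i), card_univ, Fintype.card_fin] at h
  have := i.pos
  omega

lemma erase_eq_deleteIndex_union_deleteIndex (S : Finset (IndexPair t)) (e : IndexPair t) :
    S.erase e = deleteIndex S e.1.2 ∪ deleteIndex S e.1.1 := by
  obtain ⟨⟨i, j⟩, hij⟩ := e
  ext ⟨⟨a, b⟩, hab⟩
  simp only [deleteIndex, mem_erase, mem_union, mem_filter, ne_eq, Subtype.mk.injEq, Prod.mk.injEq]
  grind

/-- `X` satisfies the binary constraint `R p` for every index pair `p ∈ S`. -/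
def SatisfiesOn (R : IndexPair t → V → V → Prop) (S : Finset (IndexPair t)) (X : Fin t → V) :
    Prop :=
  ∀ p ∈ S, R p (X p.1.1) (X p.1.2)

lemma satisfiesOn_deleteIndex_update (R : IndexPair t → V → V → Prop) (S : Finset (IndexPair t))
    (X : Fin t → V) (i : Fin t) (x : V) :
    SatisfiesOn R (deleteIndex S i) (update X i x) ↔ SatisfiesOn R (deleteIndex S i) X := by
  refine forall₂_congr fun p hp => ?_
  obtain ⟨h₁, h₂⟩ := not_or.1 (mem_filter.1 hp).2
  rw [update_of_ne h₁, update_of_ne h₂]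

lemma satisfiesOn_erase_update_update (R : IndexPair t → V → V → Prop)
    (S : Finset (IndexPair t)) (e : IndexPair t) (X : Fin t → V) (x y : V) :
    SatisfiesOn R (S.erase e) (update (update X e.1.1 x) e.1.2 y) ↔
      SatisfiesOn R (deleteIndex S e.1.2) (update X e.1.1 x) ∧
        SatisfiesOn R (deleteIndex S e.1.1) (update X e.1.2 y) := by
  rw [SatisfiesOn, erase_eq_deleteIndex_union_deleteIndex, forall_mem_union]
  refine and_congr (satisfiesOn_deleteIndex_update ..) ?_
  rw [update_comm e.2.ne]
  exact satisfiesOn_deleteIndex_update ..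

open Classical in
/-- The points of `A ^ t` that satisfy the constraints `R` on `S`. -/
noncomputable def constrainedTuples (A : Finset V) (R : IndexPair t → V → V → Prop)
    (S : Finset (IndexPair t)) : Finset (Fin t → V) :=
  {X ∈ Fintype.piFinset fun _ => A | SatisfiesOn R S X}

lemma constrainedTuples_empty (A : Finset V) (R : IndexPair t → V → V → Prop) :
    constrainedTuples A R ∅ = Fintype.piFinset fun _ => A := by
  simp [constrainedTuples, SatisfiesOn]

open Classical in
/-- The values in `A` for the coordinate `i` which, together with the other coordinates of `X`,
satisfy the constraints `R` on `S`. -/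
noncomputable def admissibleValues (A : Finset V) (R : IndexPair t → V → V → Prop)
    (S : Finset (IndexPair t)) (X : Fin t → V) (i : Fin t) : Finset V :=
  {x ∈ A | SatisfiesOn R S (update X i x)}

lemma sum_card_admissibleValues (A : Finset V) (R : IndexPair t → V → V → Prop)
    (S : Finset (IndexPair t)) (i : Fin t) :
    ∑ X ∈ Fintype.piFinset fun _ => A, #(admissibleValues A R S X i) =
      #A * #(constrainedTuples A R S) := by
  classical
  simp only [admissibleValues, constrainedTuples, card_filter]
  rw [sum_piFinset_sum_update (fun _ => A) i fun X => if SatisfiesOn R S X then 1 else 0,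
    smul_eq_mul]

open Classical in
lemma card_mul_card_mul_card_filter_constrainedTuples_erase (A : Finset V)
    (R : IndexPair t → V → V → Prop) (S : Finset (IndexPair t)) (e : IndexPair t)
    (Q : V → V → Prop) :
    #A * (#A * #{X ∈ constrainedTuples A R (S.erase e) | Q (X e.1.1) (X e.1.2)}) =
      ∑ X ∈ Fintype.piFinset fun _ => A,
        #(Rel.interedges Q (admissibleValues A R (deleteIndex S e.1.2) X e.1.1)
          (admissibleValues A R (deleteIndex S e.1.1) X e.1.2)) := by
  have hindicator : ∀ (X : Fin t → V) (x y : V),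
      (SatisfiesOn R (S.erase e) (update (update X e.1.1 x) e.1.2 y) ∧
          Q (update (update X e.1.1 x) e.1.2 y e.1.1) (update (update X e.1.1 x) e.1.2 y e.1.2)) ↔
        (SatisfiesOn R (deleteIndex S e.1.2) (update X e.1.1 x) ∧
          SatisfiesOn R (deleteIndex S e.1.1) (update X e.1.2 y)) ∧ Q x y := by
    intro X x y
    rw [satisfiesOn_erase_update_update, update_self, update_of_ne e.2.ne, update_self]
  simp only [Rel.interedges, admissibleValues, constrainedTuples, filter_filter,
    ← filter_product, ← hindicator]
  simp only [card_filter, sum_product]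
  rw [sum_piFinset_sum_update (fun _ => A) e.1.1 fun X => ∑ y ∈ A,
      if SatisfiesOn R (S.erase e) (update X e.1.2 y) ∧
        Q (update X e.1.2 y e.1.1) (update X e.1.2 y e.1.2) then 1 else 0,
    sum_piFinset_sum_update (fun _ => A) e.1.2 fun X =>
      if SatisfiesOn R (S.erase e) X ∧ Q (X e.1.1) (X e.1.2) then 1 else 0,
    smul_eq_mul, smul_eq_mul]

open Classical in
lemma constrainedTuples_eq_filter_erase (A : Finset V) (R : IndexPair t → V → V → Prop)
    {S : Finset (IndexPair t)} {e : IndexPair t} (he : e ∈ S) :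
    constrainedTuples A R S =
      {X ∈ constrainedTuples A R (S.erase e) | R e (X e.1.1) (X e.1.2)} := by
  ext X
  have hsplit : SatisfiesOn R S X ↔ SatisfiesOn R (S.erase e) X ∧ R e (X e.1.1) (X e.1.2) := by
    conv_lhs => rw [SatisfiesOn, ← insert_erase he, forall_mem_insert, and_comm]
    rfl
  simp only [constrainedTuples, mem_filter, hsplit, and_assoc]

open Classical in
/-- The relation `R` is bijumbled (in the sense of Thomason): between any two finite sets, the
number of related pairs is the density `δ` times the number of all pairs, up to `Λ` times the
geometric mean of the two cardinalities. -/
def IsBijumbled {W : Type*} (R : V → W → Prop) (δ Λ : ℝ) : Prop :=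
  ∀ (U : Finset V) (T : Finset W),
    |(#(Rel.interedges R U T) : ℝ) - δ * (#U * #T)| ≤ Λ * (√(#U) * √(#T))

lemma IsBijumbled.abs_card_constrainedTuples_sub_erase_le {A : Finset V}
    {R : IndexPair t → V → V → Prop} {S : Finset (IndexPair t)} {e : IndexPair t} {δ Λ : ℝ}
    (hR : IsBijumbled (R e) δ Λ) (hA : A.Nonempty) (hΛ : 0 ≤ Λ) (he : e ∈ S) :
    |(#(constrainedTuples A R S) : ℝ) - δ * #(constrainedTuples A R (S.erase e))| * #A ≤
      Λ * (√(#(constrainedTuples A R (deleteIndex S e.1.2))) *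
        √(#(constrainedTuples A R (deleteIndex S e.1.1)))) := by
  classical
  have hA₀ : (0 : ℝ) < #A := by exact_mod_cast hA.card_pos
  set P := Fintype.piFinset fun _ : Fin t => A
  set U := fun X => admissibleValues A R (deleteIndex S e.1.2) X e.1.1
  set T := fun X => admissibleValues A R (deleteIndex S e.1.1) X e.1.2
  have hcount : (#A * (#A * #(constrainedTuples A R S)) : ℝ) =
      ∑ X ∈ P, (#(Rel.interedges (R e) (U X) (T X)) : ℝ) := by
    rw [constrainedTuples_eq_filter_erase A R he]
    exact_mod_cast card_mul_card_mul_card_filter_constrainedTuples_erase A R S e (R e)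
  have hcount_erase : (#A * (#A * #(constrainedTuples A R (S.erase e))) : ℝ) =
      ∑ X ∈ P, (#(U X) * #(T X) : ℝ) := by
    have h := card_mul_card_mul_card_filter_constrainedTuples_erase A R S e fun _ _ => True
    simp only [Rel.interedges, filter_true, card_product] at h
    exact_mod_cast h
  refine le_of_mul_le_mul_left ?_ hA₀
  calc #A * (|(#(constrainedTuples A R S) : ℝ) - δ * #(constrainedTuples A R (S.erase e))| * #A)
      = |∑ X ∈ P, ((#(Rel.interedges (R e) (U X) (T X)) : ℝ) - δ * (#(U X) * #(T X)))| := by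
        rw [sum_sub_distrib, ← mul_sum, ← hcount, ← hcount_erase, mul_left_comm δ, ← mul_sub,
          mul_left_comm δ, ← mul_sub, abs_mul, abs_mul, abs_of_pos hA₀, mul_comm |_| (#A : ℝ)]
    _ ≤ ∑ X ∈ P, Λ * (√(#(U X)) * √(#(T X))) :=
        (abs_sum_le_sum_abs _ _).trans (sum_le_sum fun X _ => hR _ _)
    _ ≤ Λ * (√(∑ X ∈ P, (#(U X) : ℝ)) * √(∑ X ∈ P, (#(T X) : ℝ))) := by
        rw [← mul_sum]
        gcongr
        exact Real.sum_sqrt_mul_sqrt_le _ (fun _ => Nat.cast_nonneg _) fun _ => Nat.cast_nonneg _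
    _ = #A * (Λ * (√(#(constrainedTuples A R (deleteIndex S e.1.2))) *
          √(#(constrainedTuples A R (deleteIndex S e.1.1))))) := by
        rw [← Nat.cast_sum, ← Nat.cast_sum, sum_card_admissibleValues, sum_card_admissibleValues,
          Nat.cast_mul, Nat.cast_mul, Real.sqrt_mul hA₀.le, Real.sqrt_mul hA₀.le,
          mul_mul_mul_comm, Real.mul_self_sqrt hA₀.le]
        ring

lemma IsBijumbled.abs_card_constrainedTuples_sub_erase_le_of_le {A : Finset V}
    {R : IndexPair t → V → V → Prop} {S : Finset (IndexPair t)} {e : IndexPair t} {δ Λ B : ℝ}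
    (hR : IsBijumbled (R e) δ Λ) (hA : A.Nonempty) (hΛ : 0 ≤ Λ) (he : e ∈ S)
    (h₂ : Λ * #(constrainedTuples A R (deleteIndex S e.1.2)) ≤ B * #A)
    (h₁ : Λ * #(constrainedTuples A R (deleteIndex S e.1.1)) ≤ B * #A) :
    |(#(constrainedTuples A R S) : ℝ) - δ * #(constrainedTuples A R (S.erase e))| ≤ B := by
  refine le_of_mul_le_mul_right ?_ (show (0 : ℝ) < #A by exact_mod_cast hA.card_pos)
  calc |(#(constrainedTuples A R S) : ℝ) - δ * #(constrainedTuples A R (S.erase e))| * #A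
      ≤ √Λ * √Λ * (√(#(constrainedTuples A R (deleteIndex S e.1.2))) *
          √(#(constrainedTuples A R (deleteIndex S e.1.1)))) := by
        rw [Real.mul_self_sqrt hΛ]
        exact hR.abs_card_constrainedTuples_sub_erase_le hA hΛ he
    _ = √(Λ * #(constrainedTuples A R (deleteIndex S e.1.2))) *
          √(Λ * #(constrainedTuples A R (deleteIndex S e.1.1))) := by
        rw [mul_mul_mul_comm, Real.sqrt_mul hΛ, Real.sqrt_mul hΛ]
    _ ≤ √(B * #A) * √(B * #A) := by gcongr
    _ = B * #A := Real.mul_self_sqrt (h₁.trans' (by positivity))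

lemma mul_card_constrainedTuples_deleteIndex_le {A : Finset V} {R : IndexPair t → V → V → Prop}
    {S : Finset (IndexPair t)} {i : Fin t} {δ Λ η : ℝ} (hδ : 0 ≤ δ) (hη : 0 ≤ η)
    (hΛA : Λ ≤ η * δ ^ occurrences S i * #A)
    (h : |(#(constrainedTuples A R (deleteIndex S i)) : ℝ) - δ ^ #(deleteIndex S i) * #A ^ t| ≤
      ((1 + η) ^ #(deleteIndex S i) - 1) * (δ ^ #(deleteIndex S i) * #A ^ t)) :
    Λ * #(constrainedTuples A R (deleteIndex S i)) ≤
      η * (1 + η) ^ #(deleteIndex S i) * (δ ^ #S * #A ^ t) * #A :=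
  calc Λ * #(constrainedTuples A R (deleteIndex S i))
      ≤ (η * δ ^ occurrences S i * #A) *
        ((1 + η) ^ #(deleteIndex S i) * (δ ^ #(deleteIndex S i) * #A ^ t)) := by
        gcongr
        linarith [(abs_le.1 h).2]
    _ = η * (1 + η) ^ #(deleteIndex S i) * (δ ^ #S * #A ^ t) * #A := by
        rw [← card_deleteIndex_add_occurrences S i, pow_add]
        ring

lemma abs_card_constrainedTuples_sub_le {A : Finset V} {R : IndexPair t → V → V → Prop}
    {S : Finset (IndexPair t)} {δ Λ η : ℝ} (hA : A.Nonempty) (hδ₀ : 0 ≤ δ) (hδ₁ : δ ≤ 1)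
    (hΛ : 0 ≤ Λ) (hη : 0 ≤ η) (hR : ∀ p ∈ S, IsBijumbled (R p) δ Λ)
    (hΛA : ∀ i, Λ ≤ η * δ ^ occurrences S i * #A) :
    |(#(constrainedTuples A R S) : ℝ) - δ ^ #S * #A ^ t| ≤
      ((1 + η) ^ #S - 1) * (δ ^ #S * #A ^ t) := by
  induction S using Finset.strongInduction with
  | H S ih =>
    obtain rfl | ⟨e, he⟩ := S.eq_empty_or_nonempty
    · simp [constrainedTuples_empty]
    set N : Finset (IndexPair t) → ℝ := fun T => #(constrainedTuples A R T)
    set M : ℝ := δ ^ #S * #A ^ t with hM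
    have hsub : ∀ T ⊂ S, |N T - δ ^ #T * #A ^ t| ≤ ((1 + η) ^ #T - 1) * (δ ^ #T * #A ^ t) :=
      fun T hT => ih T hT (fun p hp => hR p (hT.subset hp)) fun i => (hΛA i).trans <| by
        have := pow_le_pow_of_le_one hδ₀ hδ₁ (occurrences_mono hT.subset i)
        gcongr
    have hcard : #(S.erase e) + 1 = #S := card_erase_add_one he
    have hdelete : ∀ i, e.1.1 = i ∨ e.1.2 = i →
        Λ * N (deleteIndex S i) ≤ η * (1 + η) ^ #(S.erase e) * M * #A := by
      intro i hi
      have hss : deleteIndex S i ⊆ S.erase e :=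
        subset_erase.2 ⟨filter_subset _ _, fun h => (mem_filter.1 h).2 hi⟩
      refine (mul_card_constrainedTuples_deleteIndex_le hδ₀ hη (hΛA i)
        (hsub _ (hss.trans_ssubset (erase_ssubset he)))).trans ?_
      gcongr
      linarith
    calc |N S - M|
        ≤ |N S - δ * N (S.erase e)| + |δ * N (S.erase e) - M| := abs_sub_le _ _ _
      _ = |N S - δ * N (S.erase e)| + δ * |N (S.erase e) - δ ^ #(S.erase e) * #A ^ t| := by
          rw [hM, ← hcard, pow_succ', mul_assoc, ← mul_sub, abs_mul, abs_of_nonneg hδ₀]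
      _ ≤ η * (1 + η) ^ #(S.erase e) * M +
          δ * (((1 + η) ^ #(S.erase e) - 1) * (δ ^ #(S.erase e) * #A ^ t)) := by
          gcongr
          · exact (hR e he).abs_card_constrainedTuples_sub_erase_le_of_le hA hΛ he
              (hdelete _ (.inr rfl)) (hdelete _ (.inl rfl))
          · exact hsub _ (erase_ssubset he)
      _ = ((1 + η) ^ #S - 1) * M := by
          rw [hM, ← hcard]
          ring

end ConstraintSystems

section OperatorNorm

open Matrix
open scoped Matrix.Norms.L2Operator Kronecker

variable {m n : Type*} [Fintype m] [Fintype n] [DecidableEq n]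

lemma norm_sum_sum_le_l2_opNorm (M : Matrix m n ℂ) (U : Finset m) (T : Finset n) :
    ‖∑ x ∈ U, ∑ y ∈ T, M x y‖ ≤ ‖M‖ * (√(#U) * √(#T)) := by
  classical
  set u : EuclideanSpace ℂ m := WithLp.toLp 2 fun x => if x ∈ U then 1 else 0
  set w : EuclideanSpace ℂ n := WithLp.toLp 2 fun y => if y ∈ T then 1 else 0
  have hu : ‖u‖ = √(#U) := by
    rw [EuclideanSpace.norm_eq]
    simp [u, apply_ite, ite_pow]
  have hw : ‖w‖ = √(#T) := by
    rw [EuclideanSpace.norm_eq]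
    simp [w, apply_ite, ite_pow]
  have hinner : inner ℂ u (WithLp.toLp 2 (M *ᵥ w)) = ∑ x ∈ U, ∑ y ∈ T, M x y := by
    simp [u, w, PiLp.inner_apply, mulVec, dotProduct]
  rw [← hinner, ← hu, ← hw, mul_left_comm]
  exact (norm_inner_le_norm _ _).trans
    (mul_le_mul_of_nonneg_left (l2_opNorm_mulVec M w) (norm_nonneg _))

open Classical in
lemma isBijumbled_of_l2_opNorm_le {R : m → n → Prop} {δ Λ : ℝ} {M : Matrix m n ℂ}
    (hM : ∀ x y, M x y = (if R x y then 1 else 0) - (δ : ℂ)) (hΛ : ‖M‖ ≤ Λ) :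
    IsBijumbled R δ Λ := by
  intro U T
  calc |(#(Rel.interedges R U T) : ℝ) - δ * (#U * #T)|
      = ‖∑ x ∈ U, ∑ y ∈ T, M x y‖ := by
        rw [← Real.norm_eq_abs, ← Complex.norm_real]
        simp only [hM, Rel.interedges, card_filter, sum_product, sum_sub_distrib, sum_const,
          nsmul_eq_mul]
        push_cast [apply_ite Complex.ofReal]
        ring_nf
    _ ≤ Λ * (√(#U) * √(#T)) :=
        (norm_sum_sum_le_l2_opNorm _ U T).trans (mul_le_mul_of_nonneg_right hΛ (by positivity))

/-- `A ↦ A ⊗ₖ 1` as a star homomorphism. -/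
def kroneckerOneHom (m n : Type*) [Fintype m] [Fintype n] [DecidableEq n] :
    Matrix m m ℂ →⋆ₙₐ[ℂ] Matrix (m × n) (m × n) ℂ where
  toFun A := A ⊗ₖ 1
  map_smul' c A := smul_kronecker c A 1
  map_zero' := zero_kronecker _
  map_add' A B := add_kronecker A B 1
  map_mul' A B := by rw [← mul_kronecker_mul, one_mul]
  map_star' A := by simp [star_eq_conjTranspose, conjTranspose_kronecker]

/-- `B ↦ 1 ⊗ₖ B` as a star homomorphism. -/
def oneKroneckerHom (m n : Type*) [Fintype m] [Fintype n] [DecidableEq m] :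
    Matrix n n ℂ →⋆ₙₐ[ℂ] Matrix (m × n) (m × n) ℂ where
  toFun B := 1 ⊗ₖ B
  map_smul' c B := kronecker_smul c 1 B
  map_zero' := kronecker_zero _
  map_add' A B := kronecker_add 1 A B
  map_mul' A B := by rw [← mul_kronecker_mul, one_mul]
  map_star' A := by simp [star_eq_conjTranspose, conjTranspose_kronecker]

lemma l2_opNorm_kronecker_le [DecidableEq m] (A : Matrix m m ℂ) (B : Matrix n n ℂ) :
    ‖A ⊗ₖ B‖ ≤ ‖A‖ * ‖B‖ :=
  calc ‖A ⊗ₖ B‖ = ‖kroneckerOneHom m n A * oneKroneckerHom m n B‖ := by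
        rw [show kroneckerOneHom m n A * oneKroneckerHom m n B = (A * 1) ⊗ₖ (1 * B) from
          (mul_kronecker_mul A 1 1 B).symm, mul_one, one_mul]
    _ ≤ ‖kroneckerOneHom m n A‖ * ‖oneKroneckerHom m n B‖ := norm_mul_le _ _
    _ ≤ ‖A‖ * ‖B‖ := by
        gcongr <;> exact NonUnitalStarAlgHom.norm_apply_le _ _

end OperatorNorm

section SumMatrix

open Matrix
open scoped Matrix.Norms.L2Operator Kronecker

/-- The sum-Cayley matrix of `f`, with entry `f (x + y)` in row `x` and column `y`. -/
def sumMatrix {G : Type*} [Add G] (f : G → ℂ) : Matrix G G ℂ :=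
  of fun x y => f (x + y)

lemma isStarProjection_inv_card_smul_sumMatrix_one {G : Type*} [AddGroup G] [Fintype G] :
    IsStarProjection ((Fintype.card G : ℂ)⁻¹ • sumMatrix (1 : G → ℂ)) where
  isIdempotentElem := by
    ext
    simp [sumMatrix, mul_apply]
  isSelfAdjoint := by
    ext
    simp [sumMatrix]

lemma l2_opNorm_sumMatrix_one_le {G : Type*} [AddGroup G] [Fintype G] [DecidableEq G] :
    ‖sumMatrix (1 : G → ℂ)‖ ≤ Fintype.card G := by
  have hcard : (Fintype.card G : ℂ) ≠ 0 := Nat.cast_ne_zero.2 Fintype.card_ne_zero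
  rw [← smul_inv_smul₀ hcard (sumMatrix 1), norm_smul, Complex.norm_natCast]
  exact mul_le_of_le_one_right (Nat.cast_nonneg _)
    isStarProjection_inv_card_smul_sumMatrix_one.norm_le

lemma l2_opNorm_card_smul_one_sub_sumMatrix_one_le {G : Type*} [AddGroup G] [Fintype G]
    [DecidableEq G] :
    ‖(Fintype.card G : ℂ) • (1 : Matrix G G ℂ) - sumMatrix 1‖ ≤ Fintype.card G := by
  have hcard : (Fintype.card G : ℂ) ≠ 0 := Nat.cast_ne_zero.2 Fintype.card_ne_zero
  rw [← smul_inv_smul₀ hcard (sumMatrix 1), ← smul_sub, norm_smul, Complex.norm_natCast]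
  exact mul_le_of_le_one_right (Nat.cast_nonneg _)
    isStarProjection_inv_card_smul_sumMatrix_one.one_sub.norm_le

lemma l2_opNorm_sumMatrix_pi_single_le {G : Type*} [AddGroup G] [Fintype G] [DecidableEq G] :
    ‖sumMatrix (Pi.single (0 : G) 1)‖ ≤ 1 := by
  have hunitary : sumMatrix (Pi.single (0 : G) 1) ∈ unitary (Matrix G G ℂ) := by
    rw [← unitaryGroup, mem_unitaryGroup_iff]
    ext x y
    simp [sumMatrix, mul_apply, Pi.single_apply, add_eq_zero_iff_neg_eq, one_apply, eq_comm]
  exact (CStarRing.norm_of_mem_unitary hunitary).le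

variable {K : Type*} [Field K] [Fintype K]

lemma sum_mulChar_add_mul_inv_add [DecidableEq K] {R : Type*} [CommRing R] [IsDomain R]
    {ψ : MulChar K R} (hψ : ψ ≠ 1) (a b : K) :
    ∑ y, ψ (a + y) * ψ⁻¹ (b + y) = (if a = b then (Fintype.card K : R) else 0) - 1 := by
  split_ifs with hab
  · calc ∑ y, ψ (a + y) * ψ⁻¹ (b + y) = ∑ z, (1 : MulChar K R) z := by
          rw [← Equiv.sum_comp (Equiv.addLeft a) (1 : MulChar K R)]
          simp [← hab, ← MulChar.mul_apply]
      _ = Fintype.card K - 1 := by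
          rw [MulChar.sum_one_eq_card_units, Fintype.card_eq_card_units_add_one (α := K)]
          simp
  · have hab' : a - b ≠ 0 := sub_ne_zero.2 hab
    calc ∑ y, ψ (a + y) * ψ⁻¹ (b + y)
        = ∑ z, ψ (-1) * (ψ z * ψ⁻¹ (1 - z)) := by
          refine (Equiv.sum_comp ((Equiv.mulLeft₀ (a - b) hab').trans (Equiv.addLeft (-a)))
            _).symm.trans (sum_congr rfl fun z _ => ?_)
          have hb : b + (-a + (a - b) * z) = -((a - b) * (1 - z)) := by ring
          simp only [Equiv.trans_apply, Equiv.mulLeft₀_apply, Equiv.coe_addLeft,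
            add_neg_cancel_left, MulChar.inv_apply', hb, inv_neg, mul_inv, ← map_mul]
          congr 1
          field_simp
      _ = ψ (-1) * jacobiSum ψ ψ⁻¹ := (mul_sum ..).symm
      _ = 0 - 1 := by
          rw [jacobiSum_nontrivial_inv hψ, mul_neg, ← map_mul]
          simp

lemma l2_opNorm_sumMatrix_mulChar_le [DecidableEq K] {ψ : MulChar K ℂ} (hψ : ψ ≠ 1) :
    ‖sumMatrix ψ‖ ≤ √(Fintype.card K) := by
  have hgram : sumMatrix ψ * star (sumMatrix ψ) = (Fintype.card K : ℂ) • 1 - sumMatrix 1 := by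
    ext a b
    simpa [sumMatrix, mul_apply, one_apply, ← MulChar.star_apply'] using
      sum_mulChar_add_mul_inv_add hψ a b
  refine Real.le_sqrt_of_sq_le ?_
  rw [sq, ← CStarRing.norm_self_mul_star, hgram]
  exact l2_opNorm_card_smul_one_sub_sumMatrix_one_le

lemma l2_opNorm_sumMatrix_kronecker_mulChar_le [DecidableEq K] {ψ φ : MulChar K ℂ} (hψ : ψ ≠ 1)
    (hφ : φ ≠ 1) : ‖sumMatrix ψ ⊗ₖ sumMatrix φ‖ ≤ Fintype.card K :=
  calc ‖sumMatrix ψ ⊗ₖ sumMatrix φ‖ ≤ ‖sumMatrix ψ‖ * ‖sumMatrix φ‖ := l2_opNorm_kronecker_le _ _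
    _ ≤ √(Fintype.card K) * √(Fintype.card K) := by
        gcongr <;> exact l2_opNorm_sumMatrix_mulChar_le (by assumption)
    _ = Fintype.card K := Real.mul_self_sqrt (Nat.cast_nonneg _)

end SumMatrix

section NormCharacters

variable {F : Type*} [Field F]

/-- The multiplicative character `χ ∘ N` of `K`, where `N` is the norm of `K / F`. -/
noncomputable def normChar (K : Type*) [Field K] [Algebra F K] [Module.Finite F K]
    (χ : MulChar F ℂ) : MulChar K ℂ where
  toMonoidHom := χ.toMonoidHom.comp (Algebra.norm F)
  map_nonunit' a ha := by
    have ha₀ : a = 0 := by simpa using ha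
    simp [ha₀, MulChar.map_zero]

lemma normChar_apply {K : Type*} [Field K] [Algebra F K] [Module.Finite F K] (χ : MulChar F ℂ)
    (x : K) : normChar K χ x = χ (Algebra.norm F x) := rfl

lemma normChar_ne_one {K : Type*} [Field K] [Algebra F K] [Finite F] [Finite K]
    {χ : MulChar F ℂ} (hχ : χ ≠ 1) : normChar K χ ≠ 1 := by
  obtain ⟨a, ha⟩ := MulChar.ne_one_iff.1 hχ
  obtain ⟨x, hx⟩ := FiniteField.unitsMap_norm_surjective F K a
  refine MulChar.ne_one_iff.2 ⟨x, ?_⟩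
  rwa [normChar_apply, ← Units.coe_map, hx]

lemma norm_mulChar_coe_units {M : Type*} [CommMonoid M] [Finite Mˣ] (χ : MulChar M ℂ) (a : Mˣ) :
    ‖χ a‖ = 1 :=
  ((χ.toMonoidHom.comp (Units.coeHom M)).isOfFinOrder (isOfFinOrder_of_finite a)).norm_eq_one

variable [Fintype F]

lemma card_sub_one_pos : (0 : ℝ) < Fintype.card F - 1 := by
  rw [sub_pos]
  exact_mod_cast Fintype.one_lt_card

lemma norm_inv_card_sub_one :
    ‖((Fintype.card F : ℂ) - 1)⁻¹‖ = ((Fintype.card F : ℝ) - 1)⁻¹ := by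
  rw [norm_inv, ← Complex.ofReal_natCast, ← Complex.ofReal_one, ← Complex.ofReal_sub,
    Complex.norm_of_nonneg card_sub_one_pos.le]

variable [Fintype (MulChar F ℂ)]

lemma card_mulChar : (Fintype.card (MulChar F ℂ) : ℂ) = Fintype.card F - 1 := by
  have h := MulChar.card_eq_card_units_of_hasEnoughRootsOfUnity F ℂ
  rw [Nat.card_eq_fintype_card, Nat.card_units, Nat.card_eq_fintype_card] at h
  simp [h, Nat.cast_sub Fintype.card_pos]

lemma sum_mulChar_apply [DecidableEq F] (a : F) :
    ∑ χ : MulChar F ℂ, χ a = if a = 1 then (Fintype.card F - 1 : ℂ) else 0 := by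
  split_ifs with ha
  · simp [ha, card_mulChar]
  · obtain ⟨χ, hχ⟩ := MulChar.exists_apply_ne_one_of_hasEnoughRootsOfUnity F ℂ ha
    refine eq_zero_of_mul_eq_self_left hχ ?_
    simp only [mul_sum, ← MulChar.mul_apply]
    exact Fintype.sum_bijective _ (Group.mulLeft_bijective χ) _ _ fun _ => rfl

-- Orthogonality gives `∑ χ, χ a * χ⁻¹ b = q - 1` if `a = b ≠ 0` and `0` otherwise; the terms with
-- `a = 0` or `b = 0` correct the trivial character and the missing diagonal entry `a = b = 0`.
lemma ite_eq_sub_inv_card_sub_one [DecidableEq F] [DecidableEq (MulChar F ℂ)] (a b : F) :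
    ((if a = b then 1 else 0) - ((Fintype.card F : ℂ) - 1)⁻¹ : ℂ) =
      ((Fintype.card F : ℂ) - 1)⁻¹ * (∑ χ ∈ {χ : MulChar F ℂ | χ ≠ 1}, χ a * χ⁻¹ b -
        (if a = 0 then 1 else 0) - (if b = 0 then 1 else 0) +
        Fintype.card F * ((if a = 0 then 1 else 0) * (if b = 0 then 1 else 0))) := by
  have hq : (Fintype.card F : ℂ) - 1 ≠ 0 := by
    rw [sub_ne_zero]
    exact_mod_cast Fintype.one_lt_card.ne'
  have hsum : ∑ χ ∈ {χ : MulChar F ℂ | χ ≠ 1}, χ a * χ⁻¹ b =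
      (if a * b⁻¹ = 1 then (Fintype.card F - 1 : ℂ) else 0) -
        if a * b⁻¹ = 0 then 0 else 1 := by
    have hone : (1 : MulChar F ℂ) (a * b⁻¹) = if a * b⁻¹ = 0 then 0 else 1 := by
      split_ifs with h
      · rw [h, MulChar.map_zero]
      · exact MulChar.one_apply (.mk0 _ h)
    rw [← sum_mulChar_apply, ← hone, ← sum_erase_eq_sub (mem_univ _), ← filter_ne']
    simp only [MulChar.inv_apply', ← map_mul]
  rw [hsum]
  rcases eq_or_ne a 0 with rfl | ha <;> rcases eq_or_ne b 0 with rfl | hb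
  · simp only [zero_mul, zero_ne_one, if_true, if_false]
    field_simp
    ring
  · simp [hb, hb.symm]
  · simp [ha]
  · simp only [ha, hb, mul_inv_eq_one₀ hb, mul_eq_zero, inv_eq_zero, or_self, if_false]
    split_ifs <;> (field_simp; ring)

lemma norm_sum_mulChar_ne_one_le [DecidableEq (MulChar F ℂ)] {E : Type*}
    [SeminormedAddCommGroup E] {f : MulChar F ℂ → E} {B : ℝ} (hf : ∀ χ ≠ 1, ‖f χ‖ ≤ B) :
    ‖∑ χ with χ ≠ 1, f χ‖ ≤ (Fintype.card F - 2) * B := by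
  have hcard : (#{χ : MulChar F ℂ | χ ≠ 1} : ℝ) = Fintype.card F - 2 := by
    have h : (Fintype.card (MulChar F ℂ) : ℝ) = Fintype.card F - 1 := by
      exact_mod_cast card_mulChar
    rw [filter_ne', cast_card_erase_of_mem (mem_univ _), card_univ, h]
    ring
  rw [← hcard, ← nsmul_eq_mul]
  exact (norm_sum_le _ _).trans (sum_le_card_nsmul _ _ _ fun χ hχ => hf χ (mem_filter.1 hχ).2)

end NormCharacters

section NormRelations

open Matrix
open scoped Matrix.Norms.L2Operator Kronecker

variable {F K : Type*} [Field F] [Finite F] [Field K] [Finite K] [Algebra F K]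

lemma isBijumbled_norm_add_eq {c : F} (hc : c ≠ 0) :
    IsBijumbled (fun x y : K => Algebra.norm F (x + y) = c) ((Nat.card F : ℝ) - 1)⁻¹
      √(Nat.card K) := by
  classical
  cases nonempty_fintype F
  cases nonempty_fintype K
  have := Fintype.ofFinite (MulChar F ℂ)
  simp only [Nat.card_eq_fintype_card]
  have hq : (0 : ℝ) < Fintype.card F - 1 := card_sub_one_pos
  have hK : 1 ≤ √(Fintype.card K : ℝ) := by
    rw [Real.one_le_sqrt]
    exact_mod_cast Fintype.card_pos
  refine isBijumbled_of_l2_opNorm_le (M := ((Fintype.card F : ℂ) - 1)⁻¹ •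
    (∑ χ ∈ {χ : MulChar F ℂ | χ ≠ 1}, χ⁻¹ c • sumMatrix (normChar K χ) -
      sumMatrix (Pi.single 0 1))) (fun x y => ?_) ?_
  · have h := ite_eq_sub_inv_card_sub_one (Algebra.norm F (x + y)) c
    simp only [hc, if_false, Algebra.norm_eq_zero_iff, mul_zero, add_zero, sub_zero] at h
    push_cast
    rw [h]
    simp [sumMatrix, Matrix.sum_apply, normChar_apply, Pi.single_apply, mul_comm]
  · have hsum : ‖∑ χ ∈ {χ : MulChar F ℂ | χ ≠ 1}, χ⁻¹ c • sumMatrix (normChar K χ)‖ ≤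
        (Fintype.card F - 2) * √(Fintype.card K) := by
      refine norm_sum_mulChar_ne_one_le fun χ hχ => ?_
      have hnorm : ‖χ⁻¹ c‖ = 1 := norm_mulChar_coe_units χ⁻¹ (Units.mk0 c hc)
      rw [norm_smul, hnorm, one_mul]
      exact l2_opNorm_sumMatrix_mulChar_le (normChar_ne_one hχ)
    rw [norm_smul, norm_inv_card_sub_one, inv_mul_le_iff₀ hq]
    calc ‖∑ χ ∈ {χ : MulChar F ℂ | χ ≠ 1}, χ⁻¹ c • sumMatrix (normChar K χ) -
          sumMatrix (Pi.single 0 1)‖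
        ≤ (Fintype.card F - 2) * √(Fintype.card K) + 1 :=
          (norm_sub_le _ _).trans (add_le_add hsum l2_opNorm_sumMatrix_pi_single_le)
      _ ≤ (Fintype.card F - 1) * √(Fintype.card K) := by linarith

lemma isBijumbled_norm_add_eq_norm_add :
    IsBijumbled
      (fun z w : K × K => Algebra.norm F (z.1 + w.1) = Algebra.norm F (z.2 + w.2))
      ((Nat.card F : ℝ) - 1)⁻¹ (3 * Nat.card K) := by
  classical
  cases nonempty_fintype F
  cases nonempty_fintype K
  have := Fintype.ofFinite (MulChar F ℂ)
  simp only [Nat.card_eq_fintype_card]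
  have hq : (0 : ℝ) < Fintype.card F - 1 := card_sub_one_pos
  have hqK : (Fintype.card F : ℝ) ≤ Fintype.card K := by
    exact_mod_cast Fintype.card_le_of_injective _ (algebraMap F K).injective
  have hq₂ : (2 : ℝ) ≤ Fintype.card F := by exact_mod_cast Fintype.one_lt_card
  set P := sumMatrix (Pi.single (0 : K) 1)
  set J := sumMatrix (1 : K → ℂ)
  have hP : ‖P‖ ≤ 1 := l2_opNorm_sumMatrix_pi_single_le
  have hJ : ‖J‖ ≤ Fintype.card K := l2_opNorm_sumMatrix_one_le
  refine isBijumbled_of_l2_opNorm_le (M := ((Fintype.card F : ℂ) - 1)⁻¹ •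
    (∑ χ ∈ {χ : MulChar F ℂ | χ ≠ 1}, sumMatrix (normChar K χ) ⊗ₖ sumMatrix (normChar K χ⁻¹) -
      P ⊗ₖ J - J ⊗ₖ P + (Fintype.card F : ℂ) • P ⊗ₖ P)) (fun z w => ?_) ?_
  · push_cast
    rw [ite_eq_sub_inv_card_sub_one]
    simp [P, J, sumMatrix, Matrix.sum_apply, normChar_apply, Pi.single_apply]
  · have hsum : ‖∑ χ ∈ {χ : MulChar F ℂ | χ ≠ 1},
        sumMatrix (normChar K χ) ⊗ₖ sumMatrix (normChar K χ⁻¹)‖ ≤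
          (Fintype.card F - 2) * Fintype.card K := by
      exact norm_sum_mulChar_ne_one_le fun χ hχ => l2_opNorm_sumMatrix_kronecker_mulChar_le
        (normChar_ne_one hχ) (normChar_ne_one (inv_ne_one.2 hχ))
    have hPJ : ‖P ⊗ₖ J‖ ≤ 1 * Fintype.card K := (l2_opNorm_kronecker_le _ _).trans (by gcongr)
    have hJP : ‖J ⊗ₖ P‖ ≤ Fintype.card K * 1 := (l2_opNorm_kronecker_le _ _).trans (by gcongr)
    have hPP : ‖(Fintype.card F : ℂ) • P ⊗ₖ P‖ ≤ Fintype.card F * (1 * 1) := by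
      rw [norm_smul, Complex.norm_natCast]
      gcongr
      exact (l2_opNorm_kronecker_le _ _).trans (by gcongr)
    rw [norm_smul, norm_inv_card_sub_one, inv_mul_le_iff₀ hq]
    refine (norm_add_le_of_le (norm_sub_le_of_le (norm_sub_le_of_le hsum hPJ) hJP) hPP).trans ?_
    nlinarith

end NormRelations

section NormSystems

lemma exists_one_add_pow_le (m : ℕ) {ε : ℝ} (hε : 0 < ε) : ∃ η > 0, (1 + η) ^ m ≤ 1 + ε := by
  have hlim : Filter.Tendsto (fun η : ℝ => (1 + η) ^ m) (nhdsWithin 0 (Set.Ioi 0)) (nhds 1) :=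
    tendsto_nhdsWithin_of_tendsto_nhds
      ((by fun_prop : Continuous fun η : ℝ => (1 + η) ^ m).tendsto' 0 1 (by simp))
  obtain ⟨η, hle, hη⟩ := ((hlim.eventually_le_const (by linarith : 1 < 1 + ε)).and
    self_mem_nhdsWithin).exists
  exact ⟨η, hη, hle⟩

lemma card_indexPair (t : ℕ) : Fintype.card (IndexPair t) = t.choose 2 := by
  have hcolumn : ∀ j : Fin t, ∑ i : Fin t, (if i < j then 1 else 0) = (j : ℕ) := fun j => by
    rw [← card_filter, filter_gt_eq_Iio, Fin.card_Iio]
  rw [Fintype.card_subtype, card_filter, ← univ_product_univ, sum_product_right,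
    sum_congr rfl fun j _ => hcolumn j, Fin.sum_univ_eq_sum_range (fun i => i), sum_range_id,
    Nat.choose_two_right]

lemma abs_card_constrainedTuples_sub_div_pow_le {V : Type*} {t : ℕ} {A : Finset V}
    {R : IndexPair t → V → V → Prop} {S : Finset (IndexPair t)} {q Λ η : ℝ} (hA : A.Nonempty)
    (hq₂ : 2 ≤ q) (hΛ : 0 ≤ Λ) (hη : 0 ≤ η) (hq : q ≤ (1 + η) * (q - 1))
    (hR : ∀ p ∈ S, IsBijumbled (R p) (q - 1)⁻¹ Λ)
    (hΛA : ∀ i, Λ * q ^ occurrences S i ≤ η * #A) :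
    |(#(constrainedTuples A R S) : ℝ) - #A ^ t / q ^ #S| ≤
      ((1 + η) ^ (2 * #S) - 1) * (#A ^ t / q ^ #S) := by
  have hq₁ : 1 ≤ q - 1 := by linarith
  set M : ℝ := #A ^ t / q ^ #S with hM
  set M' : ℝ := (q - 1)⁻¹ ^ #S * #A ^ t with hM'
  have hMM' : M ≤ M' := by
    rw [hM, hM', inv_pow, inv_mul_eq_div]
    gcongr
    linarith
  have hM'M : M' ≤ (1 + η) ^ #S * M := by
    rw [hM, hM', inv_pow, inv_mul_eq_div, ← mul_div_assoc, div_le_div_iff₀ (by positivity)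
      (by positivity), mul_right_comm, mul_comm, ← mul_pow]
    gcongr
  have hsub : |(#(constrainedTuples A R S) : ℝ) - M'| ≤ ((1 + η) ^ #S - 1) * M' := by
    refine abs_card_constrainedTuples_sub_le hA (by positivity) (inv_le_one_of_one_le₀ hq₁) hΛ hη
      hR fun i => ?_
    rw [inv_pow, mul_right_comm, ← div_eq_mul_inv, le_div_iff₀ (by positivity)]
    exact (by gcongr; linarith : Λ * (q - 1) ^ occurrences S i ≤ _).trans (hΛA i)
  calc |(#(constrainedTuples A R S) : ℝ) - M|
      ≤ |(#(constrainedTuples A R S) : ℝ) - M'| + |M' - M| := abs_sub_le _ _ _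
    _ ≤ ((1 + η) ^ #S - 1) * M' + (M' - M) := by rw [abs_of_nonneg (sub_nonneg.2 hMM')]; gcongr
    _ = (1 + η) ^ #S * M' - M := by ring
    _ ≤ (1 + η) ^ #S * ((1 + η) ^ #S * M) - M := by gcongr
    _ = ((1 + η) ^ (2 * #S) - 1) * M := by ring

lemma sq_card_le_card_image_mul_card_filter {α β : Type*} [DecidableEq β] (B : Finset α)
    (f : α → β) : #B ^ 2 ≤ #(B.image f) * #{z ∈ B ×ˢ B | f z.1 = f z.2} := by
  have hcollisions : #{z ∈ B ×ˢ B | f z.1 = f z.2} = ∑ b ∈ B.image f, #{x ∈ B | f x = b} ^ 2 := by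
    rw [card_eq_sum_card_fiberwise (f := fun z => f z.1) (t := B.image f) fun z hz =>
      mem_image_of_mem f (mem_product.1 (mem_filter.1 hz).1).1]
    refine sum_congr rfl fun b _ => ?_
    rw [sq, ← card_product]
    congr 1
    grind
  rw [hcollisions, card_eq_sum_card_image f B]
  exact sq_sum_le_card_mul_sum_sq

lemma nonempty_of_mul_rpow_le_card {V : Type*} {A : Finset V} {C q x : ℝ} (hC : 0 < C)
    (hq : 0 < q) (hA : C * q ^ x ≤ #A) : A.Nonempty := by
  have h : (0 : ℝ) < #A := hA.trans_lt' (by positivity)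
  exact card_pos.1 (by exact_mod_cast h)

lemma two_le_natCard {M : Type*} [Finite M] [Nontrivial M] : (2 : ℝ) ≤ Nat.card M := by
  exact_mod_cast Finite.one_lt_card

variable {F K : Type*} [Field F] [Field K] [Algebra F K] {t : ℕ}

lemma numSolutions_eq_card_constrainedTuples (A : Finset K) (S : Finset (IndexPair t))
    (lam : IndexPair t → F) :
    numSolutions F A S lam =
      #(constrainedTuples A (fun p x y => Algebra.norm F (x + y) = lam p) S) := by
  rw [numSolutions, ← Set.ncard_coe_finset]
  congr 1
  ext X
  rw [constrainedTuples, coe_filter]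
  simp [SolvesNormSystem, SatisfiesOn]

/-- The norms `N(X_i + X_j)`, `i < j`: the right-hand sides of the system that `X` solves. -/
noncomputable def pairNorms (F : Type*) {K : Type*} [Field F] [Field K] [Algebra F K] {t : ℕ}
    (X : Fin t → K) : IndexPair t → F :=
  fun p => Algebra.norm F (X p.1.1 + X p.1.2)

open Classical in
lemma numSolvable_eq_card_image_pairNorms (A : Finset K) :
    numSolvable F t A = #((Fintype.piFinset fun _ : Fin t => A).image (pairNorms F)) := by
  rw [numSolvable, ← Set.ncard_coe_finset]
  congr 1
  ext lam
  simp [SolvesNormSystem, pairNorms, funext_iff]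

lemma card_pow_sq_le_numSolvable_mul (A : Finset K) :
    (#A ^ t) ^ 2 ≤ numSolvable F t A * #(constrainedTuples (A ×ˢ A) (fun (_ : IndexPair t) z w =>
      Algebra.norm F (z.1 + w.1) = Algebra.norm F (z.2 + w.2)) univ) := by
  classical
  have hcollisions :
      #{z ∈ (Fintype.piFinset fun _ : Fin t => A) ×ˢ (Fintype.piFinset fun _ : Fin t => A) |
          pairNorms F z.1 = pairNorms F z.2} =
        #(constrainedTuples (A ×ˢ A) (fun (_ : IndexPair t) z w =>
          Algebra.norm F (z.1 + w.1) = Algebra.norm F (z.2 + w.2)) univ) := by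
    refine card_equiv (Equiv.arrowProdEquivProdArrow _ _ _).symm fun z => ?_
    simp [constrainedTuples, SatisfiesOn, pairNorms, funext_iff, forall_and]
  rw [numSolvable_eq_card_image_pairNorms, ← hcollisions, ← Fintype.card_fin t,
    ← Fintype.card_piFinset_const, Fintype.card_fin]
  exact sq_card_le_card_image_mul_card_filter _ _

variable [Finite F] [Finite K] {A : Finset K} {η : ℝ}

lemma abs_numSolutions_sub_le (hA : A.Nonempty) (hη : 0 ≤ η)
    (hq : (Nat.card F : ℝ) ≤ (1 + η) * (Nat.card F - 1)) {S : Finset (IndexPair t)}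
    (hcard : ∀ i, √(Nat.card K) * (Nat.card F : ℝ) ^ occurrences S i ≤ η * #A)
    {lam : IndexPair t → F} (hlam : ∀ p ∈ S, lam p ≠ 0) :
    |(numSolutions F A S lam : ℝ) - #A ^ t / Nat.card F ^ #S| ≤
      ((1 + η) ^ (2 * #S) - 1) * (#A ^ t / Nat.card F ^ #S) := by
  rw [numSolutions_eq_card_constrainedTuples]
  exact abs_card_constrainedTuples_sub_div_pow_le hA two_le_natCard (by positivity) hη hq
    (fun p hp => isBijumbled_norm_add_eq (hlam p hp)) hcard

lemma pow_choose_two_le_mul_numSolvable (hA : A.Nonempty) (hη : 0 ≤ η)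
    (hq : (Nat.card F : ℝ) ≤ (1 + η) * (Nat.card F - 1))
    (hcard : ∀ i : Fin t, 3 * Nat.card K * (Nat.card F : ℝ) ^ occurrences univ i ≤ η * #A ^ 2) :
    (Nat.card F : ℝ) ^ t.choose 2 ≤ (1 + η) ^ (2 * t.choose 2) * numSolvable F t A := by
  have hA₀ : (0 : ℝ) < (#A ^ t) ^ 2 := by
    have := hA.card_pos
    positivity
  have hq₀ : (0 : ℝ) < Nat.card F := by linarith [two_le_natCard (M := F)]
  set N := #(constrainedTuples (A ×ˢ A) (fun (_ : IndexPair t) z w =>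
    Algebra.norm F (z.1 + w.1) = Algebra.norm F (z.2 + w.2)) univ)
  have hcauchy : ((#A : ℝ) ^ t) ^ 2 ≤ numSolvable F t A * N := by
    exact_mod_cast card_pow_sq_le_numSolvable_mul (F := F) A
  have hN : |(N : ℝ) - (#A ^ t) ^ 2 / Nat.card F ^ t.choose 2| ≤
      ((1 + η) ^ (2 * t.choose 2) - 1) * ((#A ^ t) ^ 2 / Nat.card F ^ t.choose 2) := by
    have h := abs_card_constrainedTuples_sub_div_pow_le (S := univ) (hA.product hA)
      two_le_natCard (by positivity) hη hq
      (fun (_ : IndexPair t) _ => isBijumbled_norm_add_eq_norm_add (F := F) (K := K))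
      (by simpa [← sq] using hcard)
    rwa [card_product, ← sq, card_univ, card_indexPair, Nat.cast_pow, pow_right_comm] at h
  refine le_of_mul_le_mul_left ?_ hA₀
  calc ((#A : ℝ) ^ t) ^ 2 * Nat.card F ^ t.choose 2
      ≤ numSolvable F t A * ((1 + η) ^ (2 * t.choose 2) *
          ((#A ^ t) ^ 2 / Nat.card F ^ t.choose 2)) * Nat.card F ^ t.choose 2 := by
        gcongr
        refine hcauchy.trans ?_
        gcongr
        linarith [(abs_le.1 hN).2]
    _ = (#A ^ t) ^ 2 * ((1 + η) ^ (2 * t.choose 2) * numSolvable F t A) := by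
        field_simp

lemma natCard_mul_pow_le_rpow_sq {m : ℕ} {k : ℝ} (hm : (m : ℝ) ≤ k) :
    Nat.card K * (Nat.card F : ℝ) ^ m ≤
      ((Nat.card F : ℝ) ^ ((Module.finrank F K + k) / 2)) ^ 2 := by
  have hq : (1 : ℝ) ≤ Nat.card F := one_le_two.trans two_le_natCard
  rw [Module.natCard_eq_pow_finrank (K := F) (V := K), Nat.cast_pow, ← pow_add,
    ← Real.rpow_natCast, ← Real.rpow_mul_natCast (by positivity)]
  refine Real.rpow_le_rpow_of_exponent_le hq ?_
  push_cast
  linarith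

lemma sqrt_natCard_mul_pow_le_rpow {m : ℕ} {k : ℝ} (hm : (m : ℝ) ≤ k) :
    √(Nat.card K) * (Nat.card F : ℝ) ^ m ≤
      (Nat.card F : ℝ) ^ ((Module.finrank F K : ℝ) / 2 + k) := by
  have hq : (1 : ℝ) ≤ Nat.card F := one_le_two.trans two_le_natCard
  rw [Module.natCard_eq_pow_finrank (K := F) (V := K), Nat.cast_pow, Real.sqrt_eq_rpow,
    ← Real.rpow_natCast_mul (by positivity), ← Real.rpow_natCast _ m,
    ← Real.rpow_add (by positivity)]
  refine Real.rpow_le_rpow_of_exponent_le hq ?_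
  linarith

lemma one_sub_mul_pow_choose_two_le_numSolvable {C ε : ℝ} (hη : 0 ≤ η)
    (hηε : (1 + η) ^ (2 * t.choose 2) ≤ 1 + ε)
    (hq : (Nat.card F : ℝ) ≤ (1 + η) * (Nat.card F - 1)) (hC : 0 < C) (hηC : 3 ≤ η * C ^ 2)
    (hA : C * (Nat.card F : ℝ) ^ (((Module.finrank F K : ℝ) + (t - 1)) / 2) ≤ #A) :
    (1 - ε) * (Nat.card F : ℝ) ^ t.choose 2 ≤ numSolvable F t A := by
  have hA₀ : A.Nonempty :=
    nonempty_of_mul_rpow_le_card hC (two_pos.trans_le two_le_natCard) hA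
  have hcard : ∀ i : Fin t,
      3 * Nat.card K * (Nat.card F : ℝ) ^ occurrences univ i ≤ η * #A ^ 2 := fun i => by
    have hocc : (occurrences univ i : ℝ) ≤ t - 1 := by
      rw [le_sub_iff_add_le]
      exact_mod_cast occurrences_lt univ i
    calc 3 * Nat.card K * (Nat.card F : ℝ) ^ occurrences univ i
        ≤ η * C ^ 2 * ((Nat.card F : ℝ) ^ (((Module.finrank F K : ℝ) + (t - 1)) / 2)) ^ 2 := by
          rw [mul_assoc]
          gcongr
          exact natCard_mul_pow_le_rpow_sq hocc
      _ ≤ η * #A ^ 2 := by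
          rw [mul_assoc, ← mul_pow]
          gcongr
  have hε : 0 < 1 + ε := hηε.trans_lt' (by positivity)
  refine le_of_mul_le_mul_left ?_ hε
  calc (1 + ε) * ((1 - ε) * (Nat.card F : ℝ) ^ t.choose 2)
      = (Nat.card F : ℝ) ^ t.choose 2 - ε ^ 2 * (Nat.card F : ℝ) ^ t.choose 2 := by ring
    _ ≤ (Nat.card F : ℝ) ^ t.choose 2 := sub_le_self _ (by positivity)
    _ ≤ (1 + η) ^ (2 * t.choose 2) * numSolvable F t A :=
        pow_choose_two_le_mul_numSolvable hA₀ hη hq hcard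
    _ ≤ (1 + ε) * numSolvable F t A := by gcongr

lemma abs_numSolutions_sub_le_mul {C ε k : ℝ} (hη : 0 ≤ η)
    (hηε : (1 + η) ^ (2 * t.choose 2) ≤ 1 + ε)
    (hq : (Nat.card F : ℝ) ≤ (1 + η) * (Nat.card F - 1)) (hC : 0 < C) (hηC : 1 ≤ η * C)
    {S : Finset (IndexPair t)} (hk : ∀ i, occurrences S i ≤ k)
    (hA : C * (Nat.card F : ℝ) ^ ((Module.finrank F K : ℝ) / 2 + k) ≤ #A)
    {lam : IndexPair t → F} (hlam : ∀ p ∈ S, lam p ≠ 0) :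
    |(numSolutions F A S lam : ℝ) - #A ^ t / Nat.card F ^ #S| ≤
      ε * (#A ^ t / Nat.card F ^ #S) := by
  have hA₀ : A.Nonempty :=
    nonempty_of_mul_rpow_le_card hC (two_pos.trans_le two_le_natCard) hA
  have hS : #S ≤ t.choose 2 := (card_le_univ S).trans_eq (card_indexPair t)
  have herror : (1 + η) ^ (2 * #S) - 1 ≤ ε := by
    rw [sub_le_iff_le_add']
    exact hηε.trans' (pow_le_pow_right₀ (by linarith) (by gcongr))
  have hcard : ∀ i, √(Nat.card K) * (Nat.card F : ℝ) ^ occurrences S i ≤ η * #A := fun i =>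
    calc √(Nat.card K) * (Nat.card F : ℝ) ^ occurrences S i
        ≤ η * C * (Nat.card F : ℝ) ^ ((Module.finrank F K : ℝ) / 2 + k) :=
          (sqrt_natCard_mul_pow_le_rpow (hk i)).trans (le_mul_of_one_le_left (by positivity) hηC)
      _ ≤ η * #A := by
          rw [mul_assoc]
          gcongr
  refine (abs_numSolutions_sub_le hA₀ hη hq hcard hlam).trans ?_
  gcongr

end NormSystems

theorem mainTheorem10_general (t : ℕ) {ε : ℝ} (hε : 0 < ε) :
    ∃ (C : ℝ) (q₀ : ℕ), 0 < C ∧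
      ∀ (F : Type u) (K : Type v) [Field F] [Finite F] [Field K] [Algebra F K] [Module.Finite F K],
        q₀ ≤ Nat.card F →
        (∀ A : Finset K,
          C * (Nat.card F : ℝ) ^ (((Module.finrank F K : ℝ) + (t - 1)) / 2) ≤ #A →
          (1 - ε) * (Nat.card F : ℝ) ^ t.choose 2 ≤ numSolvable F t A) ∧
        ∀ (S : Finset (IndexPair t)) (k : ℝ), (∀ i, occurrences S i ≤ k) →
          ∀ A : Finset K, C * (Nat.card F : ℝ) ^ ((Module.finrank F K : ℝ) / 2 + k) ≤ #A →
          ∀ lam : IndexPair t → F, (∀ p ∈ S, lam p ≠ 0) →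
            |(numSolutions F A S lam : ℝ) - #A ^ t / Nat.card F ^ #S| ≤
              ε * (#A ^ t / Nat.card F ^ #S) := by
  obtain ⟨η, hη, hpow⟩ := exists_one_add_pow_le (2 * t.choose 2) hε
  obtain ⟨C, hC, hηC, hηC₂⟩ : ∃ C > 0, 1 ≤ η * C ∧ 3 ≤ η * C ^ 2 :=
    ⟨1 + 3 / η, by positivity, by field_simp; linarith, by field_simp; nlinarith⟩
  refine ⟨C, ⌈1 + 1 / η⌉₊, hC, fun F K _ _ _ _ _ hq₀ => ?_⟩
  have : Finite K := Module.finite_of_finite F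
  have hq : (Nat.card F : ℝ) ≤ (1 + η) * (Nat.card F - 1) := by
    have h : η * (1 + 1 / η) ≤ η * Nat.card F := by
      gcongr
      exact Nat.ceil_le.1 hq₀
    rw [mul_add, mul_one_div_cancel hη.ne'] at h
    linarith
  exact ⟨fun A => one_sub_mul_pow_choose_two_le_numSolvable hη.le hpow hq hC hηC₂,
    fun S k hk A hA lam => abs_numSolutions_sub_le_mul hη.le hpow hq hC hηC hk hA⟩

theorem mainTheorem10 :
    (∀ (t : ℕ) (ε : ℝ), 0 < ε → ∃ (C : ℝ) (q₀ : ℕ), 0 < C ∧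
      ∀ (F : Type u) (K : Type v) [Field F] [Finite F] [Field K] [Algebra F K] (q n : ℕ),
        Nat.card F = q → Module.finrank F K = n → q₀ ≤ q → 2 ≤ n →
        ∀ A : Finset K, C * (q : ℝ) ^ (((n : ℝ) + (t : ℝ)) / 2) ≤ (A.card : ℝ) →
          (1 - ε) * (q : ℝ) ^ (t.choose 2) ≤ (numSolvable F t A : ℝ)) ∧
    (∀ (t : ℕ) (ε : ℝ), 0 < ε → ∃ (C : ℝ) (q₀ : ℕ), 0 < C ∧
      ∀ (F : Type u) (K : Type v) [Field F] [Finite F] [Field K] [Algebra F K] (q n : ℕ),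
        Nat.card F = q → Module.finrank F K = n → q₀ ≤ q → 2 ≤ n →
        ∀ (S : Finset (IndexPair t)) (k l : ℕ), k ≤ t - 1 → (∀ i, occurrences S i ≤ k) →
          S.card = l →
        ∀ A : Finset K, C * (q : ℝ) ^ ((n : ℝ) / 2 + (t : ℝ) - 1) ≤ (A.card : ℝ) →
        ∀ lam : IndexPair t → F, (∀ p ∈ S, lam p ≠ 0) →
          |(numSolutions F A S lam : ℝ) - (A.card : ℝ) ^ t / (q : ℝ) ^ l| ≤
            ε * ((A.card : ℝ) ^ t / (q : ℝ) ^ l)) := by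
  refine ⟨fun t ε hε => ?_, fun t ε hε => ?_⟩ <;>
    obtain ⟨C, q₀, hC, h⟩ := mainTheorem10_general.{u, v} t hε <;>
    refine ⟨C, q₀, hC, ?_⟩
  · rintro F K _ _ _ _ _ _ rfl rfl hq hn A hA
    have : Module.Finite F K := Module.finite_of_finrank_pos (by omega)
    refine (h F K hq).1 A (hA.trans' ?_)
    gcongr
    · exact one_le_two.trans two_le_natCard
    · linarith
  · rintro F K _ _ _ _ _ _ rfl rfl hq hn S _ _ _ _ rfl A hA lam hlam
    have : Module.Finite F K := Module.finite_of_finrank_pos (by omega)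
    refine (h F K hq).2 S (t - 1) (fun i => ?_) A ?_ lam hlam
    · rw [le_sub_iff_add_le]
      exact_mod_cast occurrences_lt S i
    · rwa [← add_sub_assoc]
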